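/- Let $k$ be a field; all algebras are associative and unital over $k$, algebra maps are unital, and $\otimes=\otimes_k$. For an algebra $A$ and $R=\sum R^1\otimes R^2\in A\otimes A$ write $R^{12}=\sum R^1\otimes R^2\otimes 1$, $R^{13}=\sum R^1\otimes 1\otimes R^2$, $R^{23}=\sum 1\otimes R^1\otimes R^2$ in $A\otimes A\otimes A$. The pair $(A,R)$ is called a (finite) pentagon object if $A$ is finite-dimensional, $R$ is invertible in $A\otimes A$, and $$R^{12}R^{13}R^{23}=R^{23}R^{12}.$$ For a finite-dimensional Hopf algebra $L$ over $k$ with comultiplication $\Delta(h)=\sum h_{(1)}\otimes h_{(2)}$ and counit $\varepsilon$, let $L^*$ be the dual algebra with the convolution product $\langle fg,x\rangle=\sum\langle f,x_{(1)}\rangle\langle g,x_{(2)}\rangle$ and the left $L$-action $\langle h\cdot f,x\rangle=\langle f,xh\rangle$. The Heisenberg double $\mathcal H(L)=L\# L^*$ is the vector space $L\otimes L^*$ with the multiplication $$(h\# h^*)(g\# g^*)=\sum h_{(2)}g\,\#\,h^*(h_{(1)}\cdot g^*)$$ and the unit $1\#\varepsilon$. Its canonical element is $$\mathcal R=\sum_i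 (e_i\#\varepsilon)\otimes(1\# e_i^*)\in\mathcal H(L)\otimes\mathcal H(L),$$ where $(e_i)$ is any basis of $L$ and $(e_i^*)$ is the dual basis of $L^*$. **Corollary.** Let $A$ be a $k$-algebra and $R\in A\otimes A$. Then $(A,R)$ is a pentagon object if and only if $A$ is finite-dimensional and there exist a finite-dimensional Hopf algebra $L$ over $k$ and an algebra map $F:\mathcal H(L)\to A$ such that $R=(F\otimes F)(\mathcal R)$. -/

import Mathlib

open scoped TensorProduct

universe u v w

noncomputable section

/-! ## The pentagon equation -/

section Pentagon

variable (k : Type*) [Field k] (A : Type*) [Ring A] [Algebra k A]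

/-- `R ↦ R¹²`, that is `a ⊗ b ↦ a ⊗ b ⊗ 1`. -/
def leg12 : A ⊗[k] A →ₐ[k] A ⊗[k] (A ⊗[k] A) :=
  Algebra.TensorProduct.map (AlgHom.id k A) Algebra.TensorProduct.includeLeft

/-- `R ↦ R¹³`, that is `a ⊗ b ↦ a ⊗ 1 ⊗ b`. -/
def leg13 : A ⊗[k] A →ₐ[k] A ⊗[k] (A ⊗[k] A) :=
  Algebra.TensorProduct.map (AlgHom.id k A) Algebra.TensorProduct.includeRight

/-- `R ↦ R²³`, that is `a ⊗ b ↦ 1 ⊗ a ⊗ b`. -/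
def leg23 : A ⊗[k] A →ₐ[k] A ⊗[k] (A ⊗[k] A) :=
  Algebra.TensorProduct.includeRight

@[simp] theorem leg12_tmul (a b : A) : leg12 k A (a ⊗ₜ b) = a ⊗ₜ (b ⊗ₜ 1) := rfl

@[simp] theorem leg13_tmul (a b : A) : leg13 k A (a ⊗ₜ b) = a ⊗ₜ (1 ⊗ₜ b) := rfl

@[simp] theorem leg23_tmul (a b : A) : leg23 k A (a ⊗ₜ b) = 1 ⊗ₜ (a ⊗ₜ b) := rfl

/-- `(A, R)` is a (finite) pentagon object: `A` is a finite-dimensional `k`-algebra and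
`R ∈ A ⊗ A` is an invertible solution of the pentagon equation `R¹² R¹³ R²³ = R²³ R¹²`. -/
structure IsPentagonObject (R : A ⊗[k] A) : Prop where
  finiteDimensional : FiniteDimensional k A
  isUnit : IsUnit R
  pentagon : leg12 k A R * leg13 k A R * leg23 k A R = leg23 k A R * leg12 k A R

end Pentagon

/-! ## The Heisenberg double -/

/-- The dual `L*` of a coalgebra `L`, an algebra under the convolution product
`⟨f g, x⟩ = ⟨f, x₍₁₎⟩ ⟨g, x₍₂₎⟩` with unit the counit of `L`. -/
abbrev ConvDual (k : Type*) [Field k] (L : Type*) [Ring L] [Bialgebra k L] : Type _ :=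
  WithConv (L →ₗ[k] k)

section Action

variable (k : Type*) [Field k] (L : Type*) [Ring L] [Bialgebra k L]

/-- The left action of `L` on `L*`: `⟨h · f, x⟩ = ⟨f, x h⟩`. -/
def dualAction : L →ₐ[k] Module.End k (ConvDual k L) :=
  AlgHom.ofLinearMap
    (LinearMap.mk₂ k
      (fun (h : L) (f : ConvDual k L) =>
        (WithConv.toConv (f.ofConv ∘ₗ LinearMap.mulRight k h) : ConvDual k L))
      (fun h h' f => by ext x; simp [mul_add])
      (fun c h f => by ext x; simp)
      (fun h f f' => by ext x; simp)
      (fun c h f => by ext x; simp))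
    (by ext f x; simp)
    (fun h h' => by ext f x; simp [mul_assoc])

@[simp] theorem dualAction_apply (h : L) (f : ConvDual k L) (x : L) :
    (dualAction k L h f) x = f (x * h) := rfl

end Action

/-- The Heisenberg double `H(L) = L # L*`: the vector space `L ⊗ L*` with the smash product
multiplication `(h # f) (g # f') = h₍₂₎ g # f (h₍₁₎ · f')`, see
`HeisenbergDouble.mk_mul_mk`, and the unit `1 # ε`. -/
def HeisenbergDouble (k : Type*) [Field k] (L : Type*) [Ring L] [Bialgebra k L] : Type _ :=
  L ⊗[k] ConvDual k L

namespace HeisenbergDouble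

variable (k : Type*) [Field k] (L : Type*) [Ring L] [Bialgebra k L]

instance : AddCommGroup (HeisenbergDouble k L) :=
  inferInstanceAs (AddCommGroup (L ⊗[k] ConvDual k L))

instance : Module k (HeisenbergDouble k L) :=
  inferInstanceAs (Module k (L ⊗[k] ConvDual k L))

/-- The element `h # f` of the Heisenberg double, as a bilinear map. -/
def mk : L →ₗ[k] ConvDual k L →ₗ[k] HeisenbergDouble k L :=
  TensorProduct.mk k L (ConvDual k L)

/-- Left multiplication by `h # ε`: the map `g # f ↦ h₍₂₎ g # h₍₁₎ · f`. -/
def leftL : L →ₐ[k] Module.End k (L ⊗[k] ConvDual k L) :=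
  ((Module.endTensorEndAlgHom (R := k) (S := k) (A := k) (M := L) (N := ConvDual k L)).comp
    (Algebra.TensorProduct.map (Algebra.lmul k L) (dualAction k L))).comp
    ((Algebra.TensorProduct.comm k L L).toAlgHom.comp (Bialgebra.comulAlgHom k L))

/-- Left multiplication by `1 # f`: the map `g # f' ↦ g # f f'`. -/
def leftDual : ConvDual k L →ₐ[k] Module.End k (L ⊗[k] ConvDual k L) :=
  (Module.endTensorEndAlgHom (R := k) (S := k) (A := k) (M := L) (N := ConvDual k L)).comp
    (Algebra.TensorProduct.includeRight.comp (Algebra.lmul k (ConvDual k L)))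

/-- Left multiplication by `h # f`, which is left multiplication by `h # ε` followed by left
multiplication by `1 # f`. -/
def leftMul : L ⊗[k] ConvDual k L →ₗ[k] Module.End k (L ⊗[k] ConvDual k L) :=
  TensorProduct.lift
    ((LinearMap.mul k (Module.End k (L ⊗[k] ConvDual k L))).flip.compl₁₂
      (leftL k L).toLinearMap (leftDual k L).toLinearMap)

instance : Mul (HeisenbergDouble k L) := ⟨fun x y => leftMul k L x y⟩

instance : One (HeisenbergDouble k L) := ⟨mk k L 1 1⟩

variable {k L}

theorem leftL_tmul {ι : Type*} {h : L} (r : Coalgebra.Repr k h ι) (g : L) (f : ConvDual k L) :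
    leftL k L h (g ⊗ₜ f) =
      ∑ i ∈ r.index, (r.right i * g) ⊗ₜ[k] (dualAction k L (r.left i) f) := by
  simp [leftL, ← r.eq, LinearMap.sum_apply, Module.endTensorEndAlgHom_apply]

@[simp] theorem leftDual_tmul (f : ConvDual k L) (g : L) (f' : ConvDual k L) :
    leftDual k L f (g ⊗ₜ f') = g ⊗ₜ[k] (f * f') := by
  simp [leftDual, Module.endTensorEndAlgHom_apply]

theorem leftMul_tmul (h : L) (f : ConvDual k L) :
    leftMul k L (h ⊗ₜ f) = leftDual k L f * leftL k L h := by
  simp [leftMul]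

/-- The multiplication rule `(h # f) (g # f') = h₍₂₎ g # f (h₍₁₎ · f')`. -/
theorem mk_mul_mk {ι : Type*} {h : L} (r : Coalgebra.Repr k h ι) (f : ConvDual k L) (g : L)
    (f' : ConvDual k L) :
    mk k L h f * mk k L g f' =
      ∑ i ∈ r.index, mk k L (r.right i * g) (f * dualAction k L (r.left i) f') := by
  change leftMul k L (h ⊗ₜ f) (g ⊗ₜ f') = ∑ i ∈ r.index, _ ⊗ₜ _
  rw [leftMul_tmul, Module.End.mul_apply, leftL_tmul r, map_sum]
  simp

/-- `L*` is a module algebra: `h · (f f') = (h₍₁₎ · f) (h₍₂₎ · f')`. -/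
theorem dualAction_mul {ι : Type*} {h : L} (r : Coalgebra.Repr k h ι) (f f' : ConvDual k L) :
    dualAction k L h (f * f') =
      ∑ i ∈ r.index, dualAction k L (r.left i) f * dualAction k L (r.right i) f' := by
  ext x
  let s := Coalgebra.Repr.arbitrary k x
  have hx : Coalgebra.comul (R := k) (x * h) =
      ∑ i ∈ r.index, ∑ j ∈ s.index, (s.left j * r.left i) ⊗ₜ[k] (s.right j * r.right i) := by
    rw [Bialgebra.comul_mul, ← r.eq, ← s.eq, Finset.sum_mul_sum, Finset.sum_comm]
    simp
  rw [dualAction_apply, LinearMap.convMul_apply, hx]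
  simp [WithConv.ofConv_sum, LinearMap.sum_apply, s.convMul_apply]

theorem dualAction_one (h : L) :
    dualAction k L h 1 = Coalgebra.counit (R := k) h • (1 : ConvDual k L) := by
  ext x
  simp [mul_comm]

theorem leftL_mul_leftDual {ι : Type*} {h : L} (r : Coalgebra.Repr k h ι) (f : ConvDual k L) :
    leftL k L h * leftDual k L f =
      ∑ i ∈ r.index, leftDual k L (dualAction k L (r.left i) f) * leftL k L (r.right i) := by
  refine TensorProduct.ext' fun g f' => ?_
  let a₁ := fun i => Coalgebra.Repr.arbitrary k (r.left i)
  let a₂ := fun i => Coalgebra.Repr.arbitrary k (r.right i)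
  let Φ : L ⊗[k] (L ⊗[k] L) →ₗ[k] L ⊗[k] ConvDual k L :=
    TensorProduct.map (LinearMap.mulRight k g) (LinearMap.mul' k (ConvDual k L) ∘ₗ
      TensorProduct.map ((dualAction k L).toLinearMap.flip f)
        ((dualAction k L).toLinearMap.flip f')) ∘ₗ
      (TensorProduct.comm k (L ⊗[k] L) L).toLinearMap ∘ₗ
      (TensorProduct.assoc k L L L).symm.toLinearMap
  have key := congrArg Φ (Coalgebra.sum_tmul_tmul_eq r a₁ a₂)
  simp only [Φ, map_sum, LinearMap.comp_apply, LinearEquiv.coe_coe,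
    TensorProduct.assoc_symm_tmul, TensorProduct.comm_tmul, TensorProduct.map_tmul,
    LinearMap.mulRight_apply, LinearMap.mul'_apply, LinearMap.flip_apply,
    AlgHom.toLinearMap_apply] at key
  simp only [LinearMap.sum_apply, Module.End.mul_apply, leftDual_tmul, leftL_tmul r]
  simp only [leftL_tmul (a₂ _), map_sum, leftDual_tmul]
  rw [← key]
  refine Finset.sum_congr rfl fun i _ => ?_
  rw [dualAction_mul (a₁ i), TensorProduct.tmul_sum]

theorem leftMul_leftMul (x y : L ⊗[k] ConvDual k L) :
    leftMul k L (leftMul k L x y) = leftMul k L x * leftMul k L y := by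
  induction x with
  | zero => simp
  | add x x' hx hx' => simp only [map_add, LinearMap.add_apply, hx, hx', add_mul]
  | tmul h f =>
    induction y with
    | zero => simp
    | add y y' hy hy' => simp only [map_add, hy, hy', mul_add]
    | tmul g f' =>
      let r := Coalgebra.Repr.arbitrary k h
      have e : leftMul k L (h ⊗ₜ f) (g ⊗ₜ f') =
          ∑ i ∈ r.index, (r.right i * g) ⊗ₜ[k] (f * dualAction k L (r.left i) f') :=
        mk_mul_mk r f g f'
      rw [e, map_sum]
      simp only [leftMul_tmul, map_mul]
      rw [mul_assoc, ← mul_assoc (leftL k L h), leftL_mul_leftDual r, Finset.sum_mul,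
        Finset.mul_sum]
      simp only [mul_assoc]

theorem leftMul_one_tmul_one : leftMul k L (1 ⊗ₜ 1) = 1 := by
  rw [leftMul_tmul, map_one, map_one, mul_one]

theorem leftMul_apply_one (x : L ⊗[k] ConvDual k L) : leftMul k L x (1 ⊗ₜ 1) = x := by
  induction x with
  | zero => simp
  | add x x' hx hx' => rw [map_add, LinearMap.add_apply, hx, hx']
  | tmul h f =>
    let r := Coalgebra.Repr.arbitrary k h
    rw [leftMul_tmul, Module.End.mul_apply, leftL_tmul r, map_sum]
    simp only [leftDual_tmul, dualAction_one, mul_one, ← TensorProduct.smul_tmul]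
    rw [← TensorProduct.sum_tmul, Coalgebra.sum_counit_smul]

instance : Ring (HeisenbergDouble k L) where
  __ := (inferInstance : AddCommGroup (HeisenbergDouble k L))
  mul_assoc x y z := LinearMap.congr_fun (leftMul_leftMul (k := k) (L := L) x y) z
  one_mul x := LinearMap.congr_fun (leftMul_one_tmul_one (k := k) (L := L)) x
  mul_one x := leftMul_apply_one (k := k) (L := L) x
  left_distrib x y z := map_add (leftMul k L x) y z
  right_distrib x y z := LinearMap.congr_fun (map_add (leftMul k L) x y) z
  zero_mul x := LinearMap.congr_fun (map_zero (leftMul k L)) x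
  mul_zero x := map_zero (leftMul k L x)

instance : Algebra k (HeisenbergDouble k L) :=
  Algebra.ofModule (fun c x y => LinearMap.congr_fun (map_smul (leftMul k L) c x) y)
    (fun c x y => map_smul (leftMul k L x) c y)

theorem one_def : (1 : HeisenbergDouble k L) = mk k L 1 1 := rfl

variable (k L)

/-- The canonical element `𝓡 = ∑ᵢ (eᵢ # ε) ⊗ (1 # eᵢ*)` of `H(L) ⊗ H(L)`: the image under
`h ⊗ f ↦ (h # ε) ⊗ (1 # f)` of the canonical element `∑ᵢ eᵢ ⊗ eᵢ*` of `L ⊗ L*`. -/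
def canonicalElement [FiniteDimensional k L] :
    HeisenbergDouble k L ⊗[k] HeisenbergDouble k L :=
  TensorProduct.map ((mk k L).flip 1) (mk k L 1 ∘ₗ (WithConv.linearEquiv k (L →ₗ[k] k)).symm)
    (coevaluation k L 1)

/-- The canonical element can be computed from any basis of `L` and its dual basis. -/
theorem canonicalElement_eq_sum [FiniteDimensional k L] {ι : Type*} [Fintype ι]
    (b : Module.Basis ι k L) :
    canonicalElement k L =
      ∑ i, mk k L (b i) 1 ⊗ₜ[k] mk k L 1 (WithConv.toConv (b.coord i)) := by
  classical
  have hb : coevaluation k L 1 = ∑ i, b i ⊗ₜ[k] b.coord i := by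
    have inj : Function.Injective
        (dualTensorHom k L L ∘ₗ (TensorProduct.comm k L (Module.Dual k L)).toLinearMap) :=
      (dualTensorHomEquivOfBasis b).injective.comp (TensorProduct.comm k _ _).injective
    apply inj
    rw [coevaluation_apply_one]
    ext x
    simp only [LinearMap.comp_apply, map_sum, LinearEquiv.coe_coe, TensorProduct.comm_tmul,
      LinearMap.sum_apply, dualTensorHom_apply, Module.Basis.coord_apply, Module.Basis.sum_repr]
  rw [canonicalElement, hb, map_sum]
  rfl

end HeisenbergDouble

end

noncomputable section

section LegCalculus

open Algebra.TensorProduct (includeLeft includeRight)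

variable {k : Type*} [Field k] {L A : Type*} [Ring L] [Algebra k L] [Ring A] [Algebra k A]

theorem leg12_eq_assoc (R : A ⊗[k] A) :
    leg12 k A R = Algebra.TensorProduct.assoc k k k A A A (R ⊗ₜ 1) := by
  have : leg12 k A = (Algebra.TensorProduct.assoc k k k A A A).toAlgHom.comp includeLeft := by
    ext <;> simp
  exact DFunLike.congr_fun this R

/-- If `(Δ ⊗ id) T = T¹³ T²³` and `Δ` is implemented by conjugation with `R = (i ⊗ id) T`, then
`R` solves the pentagon equation. -/
theorem pentagon_of_comul (i : L →ₐ[k] A) (Δ : L →ₐ[k] L ⊗[k] L) (T : L ⊗[k] A)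
    (hΔ : Algebra.TensorProduct.map Δ (AlgHom.id k A) T =
      Algebra.TensorProduct.map (includeLeft : L →ₐ[k] L ⊗[k] L) (AlgHom.id k A) T *
        Algebra.TensorProduct.map (includeRight : L →ₐ[k] L ⊗[k] L) (AlgHom.id k A) T)
    (hc : ∀ h, Algebra.TensorProduct.map i (AlgHom.id k A) T *
        Algebra.TensorProduct.map i i (Δ h) =
      (1 ⊗ₜ i h) * Algebra.TensorProduct.map i (AlgHom.id k A) T) :
    leg12 k A (Algebra.TensorProduct.map i (AlgHom.id k A) T) *
      leg13 k A (Algebra.TensorProduct.map i (AlgHom.id k A) T) *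
      leg23 k A (Algebra.TensorProduct.map i (AlgHom.id k A) T) =
    leg23 k A (Algebra.TensorProduct.map i (AlgHom.id k A) T) *
      leg12 k A (Algebra.TensorProduct.map i (AlgHom.id k A) T) := by
  set R := Algebra.TensorProduct.map i (AlgHom.id k A) T with hR
  let a := (Algebra.TensorProduct.assoc k k k A A A).toAlgHom.comp
    (Algebra.TensorProduct.map (Algebra.TensorProduct.map i i) (AlgHom.id k A))
  have h13 : leg13 k A R = a (Algebra.TensorProduct.map (includeLeft : L →ₐ[k] L ⊗[k] L) (AlgHom.id k A) T) := by
    have : (leg13 k A).comp (Algebra.TensorProduct.map i (AlgHom.id k A)) =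
        a.comp (Algebra.TensorProduct.map (includeLeft : L →ₐ[k] L ⊗[k] L) (AlgHom.id k A)) := by
      ext <;> simp [a]
    exact DFunLike.congr_fun this T
  have h23 : leg23 k A R = a (Algebra.TensorProduct.map (includeRight : L →ₐ[k] L ⊗[k] L) (AlgHom.id k A) T) := by
    have : (leg23 k A).comp (Algebra.TensorProduct.map i (AlgHom.id k A)) =
        a.comp (Algebra.TensorProduct.map (includeRight : L →ₐ[k] L ⊗[k] L) (AlgHom.id k A)) := by
      ext <;> simp [a]
    exact DFunLike.congr_fun this T
  have key : ∀ X : L ⊗[k] A,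
      leg12 k A R * a (Algebra.TensorProduct.map Δ (AlgHom.id k A) X) =
        leg23 k A (Algebra.TensorProduct.map i (AlgHom.id k A) X) * leg12 k A R := by
    intro X
    induction X with
    | zero => simp
    | add x y hx hy => simp only [map_add, mul_add, add_mul, hx, hy]
    | tmul h y =>
      have e : leg23 k A (i h ⊗ₜ y) =
        Algebra.TensorProduct.assoc k k k A A A ((1 ⊗ₜ i h) ⊗ₜ y) := rfl
      simp only [a, Algebra.TensorProduct.map_tmul, AlgHom.comp_apply, AlgHom.id_apply]
      rw [e, leg12_eq_assoc]
      change Algebra.TensorProduct.assoc k k k A A A _ *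
        Algebra.TensorProduct.assoc k k k A A A _ = _
      rw [← map_mul, ← map_mul, Algebra.TensorProduct.tmul_mul_tmul,
        Algebra.TensorProduct.tmul_mul_tmul, hc, one_mul, mul_one]
  rw [mul_assoc, h13, h23, ← map_mul, ← hΔ, key T]
  rw [← h23]

theorem IsPentagonObject.map {B : Type*} [Ring B] [Algebra k B] [FiniteDimensional k B]
    {R : A ⊗[k] A} (hR : IsPentagonObject k A R) (F : A →ₐ[k] B) :
    IsPentagonObject k B (Algebra.TensorProduct.map F F R) := by
  let F₃ := Algebra.TensorProduct.map F (Algebra.TensorProduct.map F F)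
  have h12 : (leg12 k B).comp (Algebra.TensorProduct.map F F) = F₃.comp (leg12 k A) := by
    ext <;> simp [F₃]
  have h13 : (leg13 k B).comp (Algebra.TensorProduct.map F F) = F₃.comp (leg13 k A) := by
    ext <;> simp [F₃]
  have h23 : (leg23 k B).comp (Algebra.TensorProduct.map F F) = F₃.comp (leg23 k A) := by
    ext <;> simp [F₃]
  replace h12 := DFunLike.congr_fun h12 R
  replace h13 := DFunLike.congr_fun h13 R
  replace h23 := DFunLike.congr_fun h23 R
  simp only [AlgHom.comp_apply] at h12 h13 h23
  refine ⟨inferInstance, hR.isUnit.map _, ?_⟩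
  rw [h12, h13, h23, ← map_mul, ← map_mul, ← map_mul, hR.pentagon]

/-- Applying `x ⊗ y ↦ g x * y` to the first leg of `X¹³ Y²³` gives `(g ⊗ id) X * Y`. -/
theorem rTensor_mul'_map_left (g : L →ₗ[k] L) (X Y : L ⊗[k] A) :
    (LinearMap.mul' k L ∘ₗ g.rTensor L).rTensor A
      (Algebra.TensorProduct.map (includeLeft : L →ₐ[k] L ⊗[k] L) (AlgHom.id k A) X *
        Algebra.TensorProduct.map (includeRight : L →ₐ[k] L ⊗[k] L) (AlgHom.id k A) Y) = g.rTensor A X * Y := by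
  induction X with
  | zero => simp
  | add x y hx hy => simp only [map_add, add_mul, hx, hy]
  | tmul a b =>
    induction Y with
    | zero => simp
    | add x y hx hy => simp only [map_add, mul_add, hx, hy]
    | tmul c d => simp

theorem rTensor_mul'_map_right (g : L →ₗ[k] L) (X Y : L ⊗[k] A) :
    (LinearMap.mul' k L ∘ₗ g.lTensor L).rTensor A
      (Algebra.TensorProduct.map (includeLeft : L →ₐ[k] L ⊗[k] L) (AlgHom.id k A) X *
        Algebra.TensorProduct.map (includeRight : L →ₐ[k] L ⊗[k] L) (AlgHom.id k A) Y) = X * g.rTensor A Y := by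
  induction X with
  | zero => simp
  | add x y hx hy => simp only [map_add, add_mul, hx, hy]
  | tmul a b =>
    induction Y with
    | zero => simp
    | add x y hx hy => simp only [map_add, mul_add, hx, hy]
    | tmul c d => simp

end LegCalculus

namespace HeisenbergDouble

open Algebra.TensorProduct (includeLeft includeRight)

variable (k : Type*) [Field k] (L : Type*) [Ring L] [Bialgebra k L]

theorem mk_one_mul_mk (f : ConvDual k L) (h : L) (f' : ConvDual k L) :
    mk k L 1 f * mk k L h f' = mk k L h (f * f') := by
  change leftMul k L (1 ⊗ₜ f) (h ⊗ₜ f') = h ⊗ₜ (f * f')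
  rw [leftMul_tmul, map_one, mul_one, leftDual_tmul]

theorem mk_mul_mk_one (h g : L) : mk k L h 1 * mk k L g 1 = mk k L (h * g) 1 := by
  have r := Coalgebra.Repr.arbitrary k h
  rw [mk_mul_mk r]
  have e : ∀ i, mk k L (r.right i * g) (1 * dualAction k L (r.left i) 1) =
      mk k L ((Coalgebra.counit (R := k) (r.left i) • r.right i) * g) 1 := by
    intro i
    rw [dualAction_one, one_mul, map_smul, smul_mul_assoc, map_smul, LinearMap.smul_apply]
  simp only [e]
  rw [← LinearMap.sum_apply, ← map_sum, ← Finset.sum_mul, Coalgebra.sum_counit_smul]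

/-- The embedding `h ↦ h # ε`. -/
def inl : L →ₐ[k] HeisenbergDouble k L :=
  AlgHom.ofLinearMap ((mk k L).flip 1) rfl fun h g => (mk_mul_mk_one k L h g).symm

/-- The embedding `f ↦ 1 # f`. -/
def inr : ConvDual k L →ₐ[k] HeisenbergDouble k L :=
  AlgHom.ofLinearMap (mk k L 1) rfl fun f g => (mk_one_mul_mk k L f 1 g).symm

variable {k L}

theorem inl_apply (h : L) : inl k L h = mk k L h 1 := rfl

theorem inr_apply (f : ConvDual k L) : inr k L f = mk k L 1 f := rfl

theorem inl_mul_inr {ι : Type*} {h : L} (r : Coalgebra.Repr k h ι) (f : ConvDual k L) :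
    inl k L h * inr k L f =
      ∑ i ∈ r.index, inr k L (dualAction k L (r.left i) f) * inl k L (r.right i) := by
  simp only [inl_apply, inr_apply, mk_mul_mk r, mk_one_mul_mk, mul_one, one_mul]

variable (k L) in
/-- The canonical element of `L ⊗ L*`. -/
def coev [FiniteDimensional k L] : L ⊗[k] ConvDual k L :=
  ∑ i, Module.Free.chooseBasis k L i ⊗ₜ WithConv.toConv ((Module.Free.chooseBasis k L).coord i)

theorem canonicalElement_eq_map_coev [FiniteDimensional k L] :
    canonicalElement k L = Algebra.TensorProduct.map (inl k L) (inr k L) (coev k L) := by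
  rw [canonicalElement_eq_sum k L (Module.Free.chooseBasis k L), coev, map_sum]
  rfl

variable (k L) in
/-- Evaluation of a functional at `x`. -/
def evalAt (x : L) : ConvDual k L →ₗ[k] k :=
  LinearMap.applyₗ x ∘ₗ (WithConv.linearEquiv k (L →ₗ[k] k)).toLinearMap

@[simp] theorem evalAt_apply (x : L) (f : ConvDual k L) : evalAt k L x f = f x := rfl

theorem tensor_convDual_ext [FiniteDimensional k L] {V : Type*} [AddCommGroup V] [Module k V]
    {X Y : V ⊗[k] ConvDual k L}
    (h : ∀ x, (evalAt k L x).lTensor V X = (evalAt k L x).lTensor V Y) : X = Y := by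
  classical
  let b := Module.Free.chooseBasis k L
  have key : ∀ Z : V ⊗[k] ConvDual k L, Z = ∑ i,
      TensorProduct.rid k V ((evalAt k L (b i)).lTensor V Z) ⊗ₜ WithConv.toConv (b.coord i) := by
    intro Z
    induction Z with
    | zero => simp
    | add x y hx hy =>
      simp only [map_add, TensorProduct.add_tmul, Finset.sum_add_distrib]
      rw [← hx, ← hy]
    | tmul v f =>
      simp only [LinearMap.lTensor_tmul, TensorProduct.rid_tmul, evalAt_apply,
        TensorProduct.smul_tmul, ← TensorProduct.tmul_sum]
      congr 1
      apply WithConv.ofConv_injective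
      apply b.ext
      intro j
      simp [WithConv.ofConv_sum]
  rw [key X, key Y]
  simp only [h]

theorem evalAt_rTensor_coev [FiniteDimensional k L] {V : Type*} [AddCommGroup V] [Module k V]
    (g : L →ₗ[k] V) (x : L) :
    (evalAt k L x).lTensor V (g.rTensor (ConvDual k L) (coev k L)) = g x ⊗ₜ 1 := by
  have : x = ∑ i, (Module.Free.chooseBasis k L).coord i x • Module.Free.chooseBasis k L i :=
    ((Module.Free.chooseBasis k L).sum_repr x).symm
  conv_rhs => rw [this]
  simp only [coev, map_sum, LinearMap.rTensor_tmul, LinearMap.lTensor_tmul, evalAt_apply,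
    TensorProduct.sum_tmul, map_smul, TensorProduct.smul_tmul, smul_eq_mul, mul_one]

theorem map_comul_coev [FiniteDimensional k L] :
    Algebra.TensorProduct.map (Bialgebra.comulAlgHom k L) (AlgHom.id k (ConvDual k L))
        (coev k L) =
      Algebra.TensorProduct.map (includeLeft : L →ₐ[k] L ⊗[k] L) (AlgHom.id k (ConvDual k L)) (coev k L) *
        Algebra.TensorProduct.map (includeRight : L →ₐ[k] L ⊗[k] L) (AlgHom.id k (ConvDual k L)) (coev k L) := by
  refine tensor_convDual_ext fun x => ?_
  have hrT : Algebra.TensorProduct.map (Bialgebra.comulAlgHom k L) (AlgHom.id k (ConvDual k L))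
      (coev k L) = (Coalgebra.comul (R := k) (A := L)).rTensor (ConvDual k L) (coev k L) := rfl
  rw [hrT, evalAt_rTensor_coev]
  let r := Coalgebra.Repr.arbitrary k x
  let b := Module.Free.chooseBasis k L
  have e (y : L) : ∑ i, b.coord i y • b i = y := b.sum_repr y
  have h : Coalgebra.comul (R := k) x = ∑ j ∈ r.index,
      (∑ i, b.coord i (r.left j) • b i) ⊗ₜ[k] (∑ i, b.coord i (r.right j) • b i) := by
    simp only [e, r.eq]
  have hterm : ∀ i j, (b i ⊗ₜ[k] b j) ⊗ₜ[k]
        (∑ a ∈ r.index, b.coord i (r.left a) * b.coord j (r.right a)) =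
      ∑ a ∈ r.index,
        ((b.coord i (r.left a) • b i) ⊗ₜ[k] (b.coord j (r.right a) • b j)) ⊗ₜ[k] (1 : k) := by
    intro i j
    simp only [TensorProduct.tmul_sum, TensorProduct.smul_tmul_smul]
    refine Finset.sum_congr rfl fun a _ => ?_
    rw [TensorProduct.smul_tmul, smul_eq_mul, mul_one]
  rw [h]
  simp only [coev, map_sum, Algebra.TensorProduct.map_tmul, Finset.sum_mul_sum,
    Algebra.TensorProduct.includeLeft_apply, Algebra.TensorProduct.includeRight_apply,
    Algebra.TensorProduct.tmul_mul_tmul, LinearMap.lTensor_tmul, evalAt_apply, r.convMul_apply,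
    AlgHom.id_apply, one_mul, mul_one]
  simp only [TensorProduct.sum_tmul]
  simp only [TensorProduct.tmul_sum, TensorProduct.sum_tmul]
  rw [Finset.sum_comm]
  refine Finset.sum_congr rfl fun i _ => ?_
  rw [Finset.sum_comm]
  refine Finset.sum_congr rfl fun j _ => ?_
  rw [← hterm i j, TensorProduct.tmul_sum]

theorem map_id_dualAction_coev [FiniteDimensional k L] (h : L) :
    (dualAction k L h).lTensor L (coev k L) =
      (LinearMap.mulRight k h).rTensor (ConvDual k L) (coev k L) := by
  refine tensor_convDual_ext fun x => ?_
  rw [evalAt_rTensor_coev, ← LinearMap.comp_apply, ← LinearMap.lTensor_comp]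
  have : evalAt k L x ∘ₗ dualAction k L h = evalAt k L (x * h) := rfl
  rw [this]
  simpa using evalAt_rTensor_coev LinearMap.id (x * h)

/-- Conjugation by the canonical element implements the comultiplication of `L`. -/
theorem canonicalElement_mul_comul [FiniteDimensional k L] (h : L) :
    canonicalElement k L *
        Algebra.TensorProduct.map (inl k L) (inl k L) (Coalgebra.comul (R := k) h) =
      (1 ⊗ₜ inl k L h) * canonicalElement k L := by
  let r := Coalgebra.Repr.arbitrary k h
  have key : ∀ g : L,
      Algebra.TensorProduct.map (inl k L) (inr k L) (coev k L) * (inl k L g ⊗ₜ 1) =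
      Algebra.TensorProduct.map (inl k L) (inr k L) ((dualAction k L g).lTensor L (coev k L)) := by
    intro g
    rw [map_id_dualAction_coev]
    simp only [coev, map_sum, Finset.sum_mul, LinearMap.rTensor_tmul,
      Algebra.TensorProduct.map_tmul, Algebra.TensorProduct.tmul_mul_tmul, mul_one,
      LinearMap.mulRight_apply, map_mul]
  rw [canonicalElement_eq_map_coev, ← r.eq, map_sum, Finset.mul_sum]
  have this : ∀ j, Algebra.TensorProduct.map (inl k L) (inl k L) (r.left j ⊗ₜ r.right j) =
    (inl k L (r.left j) ⊗ₜ 1) * (1 ⊗ₜ inl k L (r.right j)) := by simp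
  simp only [this, ← mul_assoc, key]
  simp only [coev, map_sum, Finset.sum_mul, Finset.mul_sum, LinearMap.lTensor_tmul,
      Algebra.TensorProduct.map_tmul, Algebra.TensorProduct.tmul_mul_tmul, mul_one, one_mul,
      inl_mul_inr r, TensorProduct.tmul_sum]
  rw [Finset.sum_comm]

end HeisenbergDouble

namespace HeisenbergDouble

open Algebra.TensorProduct (includeLeft includeRight)

variable {k : Type*} [Field k] {L : Type*} [Ring L] [HopfAlgebra k L] [FiniteDimensional k L]

theorem isUnit_coev : IsUnit (coev k L) := by
  have h : (Coalgebra.comul (R := k) (A := L)).rTensor (ConvDual k L) (coev k L) = _ :=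
    map_comul_coev
  have h1 : (Algebra.linearMap k L ∘ₗ Coalgebra.counit).rTensor (ConvDual k L) (coev k L) = 1 := by
    refine tensor_convDual_ext fun x => ?_
    rw [evalAt_rTensor_coev, Algebra.TensorProduct.one_def]
    simp [Algebra.algebraMap_eq_smul_one, TensorProduct.smul_tmul]
  have l := rTensor_mul'_map_left (HopfAlgebra.antipode k (A := L)) (coev k L) (coev k L)
  have r := rTensor_mul'_map_right (HopfAlgebra.antipode k (A := L)) (coev k L) (coev k L)
  rw [← h, ← LinearMap.comp_apply, ← LinearMap.rTensor_comp, LinearMap.comp_assoc,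
    HopfAlgebra.mul_antipode_rTensor_comul, h1] at l
  rw [← h, ← LinearMap.comp_apply, ← LinearMap.rTensor_comp, LinearMap.comp_assoc,
    HopfAlgebra.mul_antipode_lTensor_comul, h1] at r
  exact ⟨⟨_, _, r.symm, l.symm⟩, rfl⟩

instance : FiniteDimensional k (ConvDual k L) :=
  Module.Finite.equiv (WithConv.linearEquiv k (L →ₗ[k] k)).symm

instance : FiniteDimensional k (HeisenbergDouble k L) :=
  inferInstanceAs (FiniteDimensional k (L ⊗[k] ConvDual k L))

theorem isPentagonObject_canonicalElement :
    IsPentagonObject k (HeisenbergDouble k L) (canonicalElement k L) := by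
  let T := Algebra.TensorProduct.map (AlgHom.id k L) (inr k L) (coev k L)
  have hT : Algebra.TensorProduct.map (inl k L) (AlgHom.id k (HeisenbergDouble k L)) T =
      canonicalElement k L := by
    rw [canonicalElement_eq_map_coev]
    have : (Algebra.TensorProduct.map (inl k L) (AlgHom.id k (HeisenbergDouble k L))).comp
        (Algebra.TensorProduct.map (AlgHom.id k L) (inr k L)) =
        Algebra.TensorProduct.map (inl k L) (inr k L) := by
      ext <;> simp
    exact DFunLike.congr_fun this _
  have hg (g : L →ₐ[k] L ⊗[k] L) :
      Algebra.TensorProduct.map g (AlgHom.id k (HeisenbergDouble k L)) T =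
        Algebra.TensorProduct.map (AlgHom.id k (L ⊗[k] L)) (inr k L)
          (Algebra.TensorProduct.map g (AlgHom.id k (ConvDual k L)) (coev k L)) := by
    have : (Algebra.TensorProduct.map g (AlgHom.id k (HeisenbergDouble k L))).comp
        (Algebra.TensorProduct.map (AlgHom.id k L) (inr k L)) =
        (Algebra.TensorProduct.map (AlgHom.id k (L ⊗[k] L)) (inr k L)).comp
          (Algebra.TensorProduct.map g (AlgHom.id k (ConvDual k L))) := by
      rw [← Algebra.TensorProduct.map_comp, ← Algebra.TensorProduct.map_comp]
      rfl
    exact DFunLike.congr_fun this _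
  refine ⟨inferInstance, ?_, ?_⟩
  · rw [canonicalElement_eq_map_coev]
    exact isUnit_coev.map _
  · rw [← hT]
    refine pentagon_of_comul (inl k L) (Bialgebra.comulAlgHom k L) T ?_ fun h => ?_
    · rw [hg, hg, hg, map_comul_coev, map_mul]
    · rw [hT]
      exact canonicalElement_mul_comul h

end HeisenbergDouble

section Slices

open Algebra.TensorProduct (includeLeft includeRight)

variable {k : Type*} [Field k] {B A : Type*} [Ring B] [Algebra k B] [Ring A] [Algebra k A]

/-- The slice `(f ⊗ id) X` of a tensor `X`. -/
def sliceLeft (f : B →ₗ[k] k) : B ⊗[k] A →ₗ[k] A :=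
  (TensorProduct.lid k A).toLinearMap ∘ₗ f.rTensor A

/-- The slice `(id ⊗ g) X` of a tensor `X`. -/
def sliceRight (g : A →ₗ[k] k) : B ⊗[k] A →ₗ[k] B :=
  (TensorProduct.rid k B).toLinearMap ∘ₗ g.lTensor B

@[simp] theorem sliceLeft_tmul (f : B →ₗ[k] k) (b : B) (a : A) :
    sliceLeft f (b ⊗ₜ[k] a) = f b • a := by
  simp [sliceLeft]

@[simp] theorem sliceRight_tmul (g : A →ₗ[k] k) (b : B) (a : A) :
    sliceRight g (b ⊗ₜ[k] a) = g a • b := by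
  simp [sliceRight]

theorem apply_sliceRight (f : B →ₗ[k] k) (g : A →ₗ[k] k) (X : B ⊗[k] A) :
    f (sliceRight g X) = g (sliceLeft f X) := by
  induction X with
  | zero => simp
  | add x y hx hy => simp only [map_add, hx, hy]
  | tmul a b => simp [mul_comm]

theorem sliceRight_rTensor {C : Type*} [Ring C] [Algebra k C] (u : B →ₗ[k] C) (g : A →ₗ[k] k)
    (X : B ⊗[k] A) : sliceRight g (u.rTensor A X) = u (sliceRight g X) := by
  induction X with
  | zero => simp
  | add x y hx hy => simp only [map_add, hx, hy]
  | tmul a b => simp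

theorem sliceLeft_rTensor {C : Type*} [Ring C] [Algebra k C] (u : B →ₗ[k] C) (f : C →ₗ[k] k)
    (X : B ⊗[k] A) : sliceLeft f (u.rTensor A X) = sliceLeft (f ∘ₗ u) X := by
  induction X with
  | zero => simp
  | add x y hx hy => simp only [map_add, hx, hy]
  | tmul a b => simp

theorem sliceLeft_lTensor {C : Type*} [Ring C] [Algebra k C] (u : A →ₗ[k] C) (f : B →ₗ[k] k)
    (X : B ⊗[k] A) : sliceLeft f (u.lTensor B X) = u (sliceLeft f X) := by
  induction X with
  | zero => simp
  | add x y hx hy => simp only [map_add, hx, hy]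
  | tmul a b => simp

theorem sliceLeft_map {C : Type*} [Ring C] [Algebra k C] (u : B →ₐ[k] C) (f : C →ₗ[k] k)
    (X : B ⊗[k] A) : sliceLeft f (Algebra.TensorProduct.map u (AlgHom.id k A) X) =
      sliceLeft (f ∘ₗ u.toLinearMap) X :=
  sliceLeft_rTensor u.toLinearMap f X

theorem sliceRight_map {C : Type*} [Ring C] [Algebra k C] (u : B →ₐ[k] C) (g : A →ₗ[k] k)
    (X : B ⊗[k] A) : sliceRight g (Algebra.TensorProduct.map u (AlgHom.id k A) X) =
      u (sliceRight g X) :=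
  sliceRight_rTensor u.toLinearMap g X

theorem eq_sum_sliceRight [FiniteDimensional k A] (X : B ⊗[k] A) :
    X = ∑ i, sliceRight ((Module.Free.chooseBasis k A).coord i) X ⊗ₜ
      Module.Free.chooseBasis k A i := by
  induction X with
  | zero => simp
  | add x y hx hy =>
    simp only [map_add, TensorProduct.add_tmul, Finset.sum_add_distrib]
    rw [← hx, ← hy]
  | tmul b a =>
    simp only [sliceRight_tmul, TensorProduct.smul_tmul, ← TensorProduct.tmul_sum]
    exact congrArg (b ⊗ₜ ·) ((Module.Free.chooseBasis k A).sum_repr a).symm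

theorem eq_sum_sliceLeft [FiniteDimensional k B] (X : B ⊗[k] A) :
    X = ∑ i, Module.Free.chooseBasis k B i ⊗ₜ
      sliceLeft ((Module.Free.chooseBasis k B).coord i) X := by
  induction X with
  | zero => simp
  | add x y hx hy =>
    simp only [map_add, TensorProduct.tmul_add, Finset.sum_add_distrib]
    rw [← hx, ← hy]
  | tmul b a =>
    simp only [sliceLeft_tmul, ← TensorProduct.smul_tmul, ← TensorProduct.sum_tmul]
    exact congrArg (· ⊗ₜ a) ((Module.Free.chooseBasis k B).sum_repr b).symm

theorem sliceRight_ext [FiniteDimensional k A] {X Y : B ⊗[k] A}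
    (h : ∀ g : A →ₗ[k] k, sliceRight g X = sliceRight g Y) : X = Y := by
  rw [eq_sum_sliceRight X, eq_sum_sliceRight Y]
  simp only [h]

theorem sliceLeft_ext [FiniteDimensional k B] {X Y : B ⊗[k] A}
    (h : ∀ f : B →ₗ[k] k, sliceLeft f X = sliceLeft f Y) : X = Y := by
  rw [eq_sum_sliceLeft X, eq_sum_sliceLeft Y]
  simp only [h]

/-- A tensor lies in `P ⊗ H` as soon as its slices lie in `P` and `H`. -/
theorem mem_range_mapIncl_of_slices [FiniteDimensional k A] [FiniteDimensional k B]
    {P : Submodule k B} {H : Submodule k A} {X : B ⊗[k] A}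
    (hP : ∀ g : A →ₗ[k] k, sliceRight g X ∈ P) (hH : ∀ f : B →ₗ[k] k, sliceLeft f X ∈ H) :
    X ∈ LinearMap.range (TensorProduct.mapIncl P H) := by
  obtain ⟨p, hp⟩ := P.subtype.exists_leftInverse_of_injective P.ker_subtype
  obtain ⟨q, hq⟩ := H.subtype.exists_leftInverse_of_injective H.ker_subtype
  have h1 : (P.subtype ∘ₗ p).rTensor A X = X := sliceRight_ext fun g => by
    rw [sliceRight_rTensor]
    exact congrArg Subtype.val (LinearMap.congr_fun hp ⟨_, hP g⟩)
  have h2 : (H.subtype ∘ₗ q).lTensor B X = X := sliceLeft_ext fun f => by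
    rw [sliceLeft_lTensor]
    exact congrArg Subtype.val (LinearMap.congr_fun hq ⟨_, hH f⟩)
  refine ⟨TensorProduct.map p q X, ?_⟩
  conv_rhs => rw [← h1, ← h2]
  change TensorProduct.map P.subtype H.subtype (TensorProduct.map p q X) = _
  rw [← LinearMap.comp_apply, ← TensorProduct.map_comp, ← LinearMap.rTensor_comp_lTensor,
    LinearMap.comp_apply]

theorem mul_mem_range_mapIncl {P : Submodule k B} {H : Submodule k A}
    (hP : ∀ x ∈ P, ∀ y ∈ P, x * y ∈ P) (hH : ∀ x ∈ H, ∀ y ∈ H, x * y ∈ H) {X Y : B ⊗[k] A}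
    (hX : X ∈ LinearMap.range (TensorProduct.mapIncl P H))
    (hY : Y ∈ LinearMap.range (TensorProduct.mapIncl P H)) :
    X * Y ∈ LinearMap.range (TensorProduct.mapIncl P H) := by
  obtain ⟨x, rfl⟩ := hX
  obtain ⟨y, rfl⟩ := hY
  induction x with
  | zero => simp
  | add x x' hx hx' => rw [map_add, add_mul]; exact add_mem hx hx'
  | tmul a b =>
    induction y with
    | zero => simp
    | add x x' hx hx' => rw [map_add, mul_add]; exact add_mem hx hx'
    | tmul c d =>
      exact ⟨⟨_, hP a a.2 c c.2⟩ ⊗ₜ ⟨_, hH b b.2 d d.2⟩, by simp [TensorProduct.mapIncl]⟩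

theorem sliceRight_mem_of_mem_range_mapIncl {P : Submodule k B} {H : Submodule k A}
    {X : B ⊗[k] A} (hX : X ∈ LinearMap.range (TensorProduct.mapIncl P H)) (g : A →ₗ[k] k) :
    sliceRight g X ∈ P := by
  obtain ⟨x, rfl⟩ := hX
  induction x with
  | zero => simp
  | add x x' hx hx' => rw [map_add, map_add]; exact add_mem hx hx'
  | tmul a b => simpa [TensorProduct.mapIncl] using P.smul_mem _ a.2

theorem sliceLeft_mem_of_mem_range_mapIncl {P : Submodule k B} {H : Submodule k A}
    {X : B ⊗[k] A} (hX : X ∈ LinearMap.range (TensorProduct.mapIncl P H)) (f : B →ₗ[k] k) :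
    sliceLeft f X ∈ H := by
  obtain ⟨x, rfl⟩ := hX
  induction x with
  | zero => simp
  | add x x' hx hx' => rw [map_add, map_add]; exact add_mem hx hx'
  | tmul a b => simpa [TensorProduct.mapIncl] using H.smul_mem _ b.2

/-- In a finite-dimensional algebra, a subspace stable under left multiplication by one of its
units is stable under left multiplication by the inverse, and so contains the unit element. -/
theorem inv_mul_mem_of_mul_mem [FiniteDimensional k A] {W : Submodule k A} (u : Aˣ)
    (h : ∀ x ∈ W, u * x ∈ W) {x : A} (hx : x ∈ W) : ↑u⁻¹ * x ∈ W := by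
  have hinj : Function.Injective (LinearMap.mulLeft k (u : A)) := fun x y hxy => by
    simpa using hxy
  have hle : W.map (LinearMap.mulLeft k (u : A)) ≤ W := by
    rintro _ ⟨y, hy, rfl⟩
    exact h y hy
  have heq := Submodule.eq_of_le_of_finrank_eq hle
    (Submodule.equivMapOfInjective _ hinj W).finrank_eq.symm
  rw [← heq] at hx
  obtain ⟨y, hy, rfl⟩ := hx
  simpa using hy

theorem sliceLeft_leg_mul_leg (f f' : B →ₗ[k] k) (X Y : B ⊗[k] A) :
    sliceLeft (LinearMap.mul' k k ∘ₗ TensorProduct.map f f')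
      (Algebra.TensorProduct.map (includeLeft : B →ₐ[k] B ⊗[k] B) (AlgHom.id k A) X *
        Algebra.TensorProduct.map (includeRight : B →ₐ[k] B ⊗[k] B) (AlgHom.id k A) Y) =
      sliceLeft f X * sliceLeft f' Y := by
  induction X with
  | zero => simp
  | add x y hx hy => simp only [map_add, add_mul, hx, hy]
  | tmul a b =>
    induction Y with
    | zero => simp
    | add x y hx hy => simp only [map_add, mul_add, hx, hy]
    | tmul c d => simp [mul_smul_mul_comm]

theorem sliceRight_leg12_mul_leg13 (g g' : A →ₗ[k] k) (X Y : A ⊗[k] A) :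
    sliceRight (LinearMap.mul' k k ∘ₗ TensorProduct.map g g') (leg12 k A X * leg13 k A Y) =
      sliceRight g X * sliceRight g' Y := by
  induction X with
  | zero => simp
  | add x y hx hy => simp only [map_add, add_mul, hx, hy]
  | tmul a b =>
    induction Y with
    | zero => simp
    | add x y hx hy => simp only [map_add, mul_add, hx, hy]
    | tmul c d => simp [mul_smul_mul_comm]

theorem sliceRight_leg23_mul_leg12_mul_leg23 (G : A ⊗[k] A →ₗ[k] k) (R R' X : A ⊗[k] A) :
    sliceRight G (leg23 k A R * leg12 k A X * leg23 k A R') =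
      sliceRight (G ∘ₗ LinearMap.mulRight k R' ∘ₗ LinearMap.mulLeft k R ∘ₗ
        (includeLeft : A →ₐ[k] A ⊗[k] A).toLinearMap) X := by
  induction X with
  | zero => simp
  | add x y hx hy => simp only [map_add, mul_add, add_mul, hx, hy]
  | tmul a b => simp [leg23]

end Slices

@[elab_as_elim]
theorem HeisenbergDouble.induction_on {k : Type*} [Field k] {L : Type*} [Ring L] [Bialgebra k L]
    {p : HeisenbergDouble k L → Prop} (x : HeisenbergDouble k L) (zero : p 0)
    (mk : ∀ h f, p (mk k L h f)) (add : ∀ x y, p x → p y → p (x + y)) : p x :=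
  TensorProduct.induction_on x zero mk add

section HeisenbergHom

open Algebra.TensorProduct (includeLeft includeRight)
open HeisenbergDouble

variable {k : Type*} [Field k] {L A : Type*} [Ring L] [Bialgebra k L] [Ring A] [Algebra k A]

/-- An element `T ∈ L ⊗ A` with `(Δ ⊗ id) T = T¹³ T²³` and `(ε ⊗ id) T = 1` defines an algebra map
`f ↦ (f ⊗ id) T` on the convolution dual of `L`. -/
def convDualHom (T : L ⊗[k] A)
    (hΔ : Algebra.TensorProduct.map (Bialgebra.comulAlgHom k L) (AlgHom.id k A) T =
      Algebra.TensorProduct.map (includeLeft : L →ₐ[k] L ⊗[k] L) (AlgHom.id k A) T *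
        Algebra.TensorProduct.map (includeRight : L →ₐ[k] L ⊗[k] L) (AlgHom.id k A) T)
    (hε : Algebra.TensorProduct.map (Bialgebra.counitAlgHom k L) (AlgHom.id k A) T = 1) :
    ConvDual k L →ₐ[k] A :=
  AlgHom.ofLinearMap
    { toFun := fun f => sliceLeft f.ofConv T
      map_add' := fun f g => by simp [sliceLeft, LinearMap.rTensor_add]
      map_smul' := fun c f => by simp [sliceLeft, LinearMap.rTensor_smul] }
    (by
      have h : sliceLeft LinearMap.id (1 : k ⊗[k] A) = 1 := by
        simp [Algebra.TensorProduct.one_def]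
      rw [← hε, sliceLeft_map] at h
      exact h)
    (fun f g => by
      have h := sliceLeft_leg_mul_leg f.ofConv g.ofConv T T
      rw [← hΔ, sliceLeft_map] at h
      exact h)

/-- An element `T ∈ L ⊗ A` with `(Δ ⊗ id) T = T¹³ T²³` and `(ε ⊗ id) T = 1` which implements the
comultiplication by conjugation comes from an algebra map on the Heisenberg double. -/
theorem exists_heisenbergDouble_hom [FiniteDimensional k L] (ι : L →ₐ[k] A) (T : L ⊗[k] A)
    (hΔ : Algebra.TensorProduct.map (Bialgebra.comulAlgHom k L) (AlgHom.id k A) T =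
      Algebra.TensorProduct.map (includeLeft : L →ₐ[k] L ⊗[k] L) (AlgHom.id k A) T *
        Algebra.TensorProduct.map (includeRight : L →ₐ[k] L ⊗[k] L) (AlgHom.id k A) T)
    (hε : Algebra.TensorProduct.map (Bialgebra.counitAlgHom k L) (AlgHom.id k A) T = 1)
    (hc : ∀ h, (1 ⊗ₜ ι h) * T =
      T * Algebra.TensorProduct.map (AlgHom.id k L) ι (Coalgebra.comul (R := k) h)) :
    ∃ F : HeisenbergDouble k L →ₐ[k] A,
      Algebra.TensorProduct.map ι (AlgHom.id k A) T =
        Algebra.TensorProduct.map F F (canonicalElement k L) := by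
  let φ := convDualHom T hΔ hε
  let F₀ : HeisenbergDouble k L →ₗ[k] A :=
    TensorProduct.lift ((LinearMap.mul k A).flip.compl₁₂ ι.toLinearMap φ.toLinearMap)
  have hF₀ (h : L) (f : ConvDual k L) : F₀ (mk k L h f) = φ f * ι h := rfl
  have h1 : F₀ 1 = 1 := by rw [one_def, hF₀, map_one, map_one, mul_one]
  have comm {h : L} (r : Coalgebra.Repr k h (L × L)) (f : ConvDual k L) :
      ∑ i ∈ r.index, φ (dualAction k L (r.left i) f) * ι (r.right i) = ι h * φ f := by
    have e1 (X : L ⊗[k] A) (x y : L) : sliceLeft f.ofConv (X * (x ⊗ₜ ι y)) =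
        sliceLeft (dualAction k L x f).ofConv X * ι y := by
      induction X with
      | zero => simp
      | add x y hx hy => simp only [map_add, add_mul, hx, hy]
      | tmul a b =>
        rw [Algebra.TensorProduct.tmul_mul_tmul, sliceLeft_tmul, sliceLeft_tmul, smul_mul_assoc]
        rfl
    have e2 (X : L ⊗[k] A) (y : A) : sliceLeft f.ofConv ((1 ⊗ₜ y) * X) =
        y * sliceLeft f.ofConv X := by
      induction X with
      | zero => simp
      | add x y hx hy => simp only [map_add, mul_add, hx, hy]
      | tmul a b => simp
    have := congrArg (sliceLeft f.ofConv) (hc h)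
    rw [e2, ← r.eq, map_sum, Finset.mul_sum, map_sum] at this
    simp only [Algebra.TensorProduct.map_tmul, AlgHom.id_apply, e1] at this
    exact this.symm
  have hmul (x y : HeisenbergDouble k L) : F₀ (x * y) = F₀ x * F₀ y := by
    induction x using HeisenbergDouble.induction_on with
    | zero => simp
    | add x x' hx hx' => rw [add_mul, map_add, map_add, hx, hx', add_mul]
    | mk h f =>
      induction y using HeisenbergDouble.induction_on with
      | zero => simp
      | add x x' hx hx' => rw [mul_add, map_add, map_add, hx, hx', mul_add]
      | mk g f' =>
        let r := Coalgebra.Repr.arbitrary k h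
        rw [mk_mul_mk r, map_sum, hF₀, hF₀]
        simp only [hF₀, map_mul]
        rw [mul_assoc, ← mul_assoc (ι h), ← comm r, Finset.sum_mul, Finset.mul_sum]
        simp only [mul_assoc]
  refine ⟨AlgHom.ofLinearMap F₀ h1 hmul, ?_⟩
  rw [canonicalElement_eq_sum k L (Module.Free.chooseBasis k L), eq_sum_sliceLeft T, map_sum,
    map_sum]
  refine Finset.sum_congr rfl fun i _ => ?_
  simp only [Algebra.TensorProduct.map_tmul, AlgHom.ofLinearMap_apply, hF₀, map_one, one_mul,
    mul_one, AlgHom.id_apply]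
  rfl

end HeisenbergHom

section HopfOfTensor

open Algebra.TensorProduct (includeLeft includeRight)

variable {k : Type*} [Field k] {L A : Type*} [Ring L] [Algebra k L] [Ring A] [Algebra k A]

/-- If the slices `(f ⊗ id) T` vanish only for `f = 0`, then a linear map `g` is determined by
`(g ⊗ id) T`. -/
theorem eq_of_rTensor_eq {T : L ⊗[k] A} (hT : ∀ f : L →ₗ[k] k, sliceLeft f T = 0 → f = 0)
    {V : Type*} [Ring V] [Algebra k V] {g g' : L →ₗ[k] V}
    (h : g.rTensor A T = g'.rTensor A T) : g = g' := by
  rw [← sub_eq_zero]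
  ext x
  rw [LinearMap.zero_apply, ← Module.forall_dual_apply_eq_zero_iff k]
  intro f
  have h0 : f ∘ₗ (g - g') = 0 := by
    apply hT
    rw [← sliceLeft_rTensor, LinearMap.rTensor_sub, LinearMap.sub_apply, h, sub_self, map_zero]
  exact LinearMap.congr_fun h0 x

theorem algHom_eq_of_map_eq {T : L ⊗[k] A} (hT : ∀ f : L →ₗ[k] k, sliceLeft f T = 0 → f = 0)
    {V : Type*} [Ring V] [Algebra k V] {g g' : L →ₐ[k] V}
    (h : Algebra.TensorProduct.map g (AlgHom.id k A) T =
      Algebra.TensorProduct.map g' (AlgHom.id k A) T) : g = g' := by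
  have : g.toLinearMap = g'.toLinearMap := eq_of_rTensor_eq hT h
  ext x
  exact LinearMap.congr_fun this x

theorem map_id_comp_apply {V W : Type*} [Ring V] [Algebra k V] [Ring W] [Algebra k W]
    (g : V →ₐ[k] W) (h : L →ₐ[k] V) (X : L ⊗[k] A) :
    Algebra.TensorProduct.map (g.comp h) (AlgHom.id k A) X =
      Algebra.TensorProduct.map g (AlgHom.id k A)
        (Algebra.TensorProduct.map h (AlgHom.id k A) X) := by
  have : Algebra.TensorProduct.map (g.comp h) (AlgHom.id k A) =
      (Algebra.TensorProduct.map g (AlgHom.id k A)).comp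
        (Algebra.TensorProduct.map h (AlgHom.id k A)) := by
    ext <;> simp
  exact DFunLike.congr_fun this X

theorem map_comp_of_map_eq_mul {V : Type*} [Ring V] [Algebra k V] (g : L ⊗[k] L →ₐ[k] V)
    {Δ : L →ₐ[k] L ⊗[k] L} {T : L ⊗[k] A}
    (hΔ : Algebra.TensorProduct.map Δ (AlgHom.id k A) T =
      Algebra.TensorProduct.map (includeLeft : L →ₐ[k] L ⊗[k] L) (AlgHom.id k A) T *
        Algebra.TensorProduct.map (includeRight : L →ₐ[k] L ⊗[k] L) (AlgHom.id k A) T) :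
    Algebra.TensorProduct.map (g.comp Δ) (AlgHom.id k A) T =
      Algebra.TensorProduct.map (g.comp includeLeft) (AlgHom.id k A) T *
        Algebra.TensorProduct.map (g.comp includeRight) (AlgHom.id k A) T := by
  rw [map_id_comp_apply, hΔ, map_mul, ← map_id_comp_apply, ← map_id_comp_apply]

/-- The bialgebra structure on an algebra `L` determined by a nondegenerate element `T ∈ L ⊗ A`
with `(Δ ⊗ id) T = T¹³ T²³` and `(ε ⊗ id) T = 1`. -/
abbrev bialgebraOfTensor (T : L ⊗[k] A)
    (hT : ∀ f : L →ₗ[k] k, sliceLeft f T = 0 → f = 0)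
    (Δ : L →ₐ[k] L ⊗[k] L) (ε : L →ₐ[k] k)
    (hΔ : Algebra.TensorProduct.map Δ (AlgHom.id k A) T =
      Algebra.TensorProduct.map (includeLeft : L →ₐ[k] L ⊗[k] L) (AlgHom.id k A) T *
        Algebra.TensorProduct.map (includeRight : L →ₐ[k] L ⊗[k] L) (AlgHom.id k A) T)
    (hε : Algebra.TensorProduct.map ε (AlgHom.id k A) T = 1) : Bialgebra k L :=
  Bialgebra.ofAlgHom Δ ε
    (by
      apply algHom_eq_of_map_eq hT
      let g : L ⊗[k] L →ₐ[k] L ⊗[k] (L ⊗[k] L) :=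
        (Algebra.TensorProduct.assoc k k k L L L).toAlgHom.comp includeLeft
      have e1 : ((Algebra.TensorProduct.assoc k k k L L L).toAlgHom.comp
          (Algebra.TensorProduct.map Δ (.id k L))).comp includeLeft = g.comp Δ := by
        ext x; simp [g]
      have e2 : ((Algebra.TensorProduct.assoc k k k L L L).toAlgHom.comp
          (Algebra.TensorProduct.map Δ (.id k L))).comp includeRight =
          (includeRight : L ⊗[k] L →ₐ[k] L ⊗[k] (L ⊗[k] L)).comp includeRight := by
        ext x; simp [Algebra.TensorProduct.one_def]
      have e3 : (Algebra.TensorProduct.map (.id k L) Δ).comp includeRight =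
          (includeRight : L ⊗[k] L →ₐ[k] L ⊗[k] (L ⊗[k] L)).comp Δ := by
        ext x; simp
      have e4 : (Algebra.TensorProduct.map (.id k L) Δ).comp includeLeft =
          g.comp includeLeft := by
        ext x; simp [g, Algebra.TensorProduct.one_def]
      have e5 : g.comp includeRight =
          (includeRight : L ⊗[k] L →ₐ[k] L ⊗[k] (L ⊗[k] L)).comp includeLeft := by
        ext x; simp [g]
      rw [← AlgHom.comp_assoc, map_comp_of_map_eq_mul _ hΔ, map_comp_of_map_eq_mul _ hΔ, e1, e2,
        e3, e4, map_comp_of_map_eq_mul _ hΔ, map_comp_of_map_eq_mul _ hΔ, e5, mul_assoc])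
    (by
      apply algHom_eq_of_map_eq hT
      have e1 : (Algebra.TensorProduct.map ε (.id k L)).comp includeLeft =
          (includeLeft : k →ₐ[k] k ⊗[k] L).comp ε := by
        ext x; simp
      rw [map_comp_of_map_eq_mul _ hΔ, e1, map_id_comp_apply, hε, map_one, one_mul]
      congr 2
      ext x; simp)
    (by
      apply algHom_eq_of_map_eq hT
      have e1 : (Algebra.TensorProduct.map (.id k L) ε).comp includeRight =
          (includeRight : k →ₐ[k] L ⊗[k] k).comp ε := by
        ext x; simp
      rw [map_comp_of_map_eq_mul _ hΔ, e1, map_id_comp_apply _ ε, hε, map_one, mul_one]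
      congr 2
      ext x; simp)

/-- The Hopf algebra structure on an algebra `L` determined by a nondegenerate invertible element
`T ∈ L ⊗ A` with `(Δ ⊗ id) T = T¹³ T²³`, `(ε ⊗ id) T = 1` and `(S ⊗ id) T = T⁻¹`. -/
abbrev hopfAlgebraOfTensor (T : L ⊗[k] A)
    (hT : ∀ f : L →ₗ[k] k, sliceLeft f T = 0 → f = 0)
    (Δ : L →ₐ[k] L ⊗[k] L) (ε : L →ₐ[k] k) (S : L →ₗ[k] L)
    (hΔ : Algebra.TensorProduct.map Δ (AlgHom.id k A) T =
      Algebra.TensorProduct.map (includeLeft : L →ₐ[k] L ⊗[k] L) (AlgHom.id k A) T *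
        Algebra.TensorProduct.map (includeRight : L →ₐ[k] L ⊗[k] L) (AlgHom.id k A) T)
    (hε : Algebra.TensorProduct.map ε (AlgHom.id k A) T = 1)
    (hl : S.rTensor A T * T = 1) (hr : T * S.rTensor A T = 1) : HopfAlgebra k L :=
  have hε' : (Algebra.linearMap k L ∘ₗ ε.toLinearMap).rTensor A T = 1 := by
    have := map_id_comp_apply (Algebra.ofId k L) ε T
    rw [hε, map_one] at this
    exact this
  { bialgebraOfTensor T hT Δ ε hΔ hε with
    antipode := S
    mul_antipode_rTensor_comul := by
      change LinearMap.mul' k L ∘ₗ S.rTensor L ∘ₗ Δ.toLinearMap =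
        Algebra.linearMap k L ∘ₗ ε.toLinearMap
      apply eq_of_rTensor_eq hT
      rw [hε', ← LinearMap.comp_assoc, LinearMap.rTensor_comp, LinearMap.comp_apply]
      have : Δ.toLinearMap.rTensor A T = _ := hΔ
      rw [this, rTensor_mul'_map_left, hl]
    mul_antipode_lTensor_comul := by
      change LinearMap.mul' k L ∘ₗ S.lTensor L ∘ₗ Δ.toLinearMap =
        Algebra.linearMap k L ∘ₗ ε.toLinearMap
      apply eq_of_rTensor_eq hT
      rw [hε', ← LinearMap.comp_assoc, LinearMap.rTensor_comp, LinearMap.comp_apply]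
      have : Δ.toLinearMap.rTensor A T = _ := hΔ
      rw [this, rTensor_mul'_map_right, hr] }

theorem exists_hopfAlgebra_heisenbergDouble_hom [FiniteDimensional k L] (ι : L →ₐ[k] A)
    (T : L ⊗[k] A) (hT : ∀ f : L →ₗ[k] k, sliceLeft f T = 0 → f = 0)
    (Δ : L →ₐ[k] L ⊗[k] L) (ε : L →ₐ[k] k) (S : L →ₗ[k] L)
    (hΔ : Algebra.TensorProduct.map Δ (AlgHom.id k A) T =
      Algebra.TensorProduct.map (includeLeft : L →ₐ[k] L ⊗[k] L) (AlgHom.id k A) T *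
        Algebra.TensorProduct.map (includeRight : L →ₐ[k] L ⊗[k] L) (AlgHom.id k A) T)
    (hε : Algebra.TensorProduct.map ε (AlgHom.id k A) T = 1)
    (hl : S.rTensor A T * T = 1) (hr : T * S.rTensor A T = 1)
    (hc : ∀ h, (1 ⊗ₜ ι h) * T = T * Algebra.TensorProduct.map (AlgHom.id k L) ι (Δ h))
    {R : A ⊗[k] A} (hR : Algebra.TensorProduct.map ι (AlgHom.id k A) T = R) :
    ∃ (H : HopfAlgebra k L) (_ : @FiniteDimensional k L _ _ H.toAlgebra.toModule)
      (F : HeisenbergDouble k L →ₐ[k] A),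
      R = Algebra.TensorProduct.map F F (HeisenbergDouble.canonicalElement k L) := by
  obtain ⟨F, hF⟩ := @exists_heisenbergDouble_hom k _ L A _
    (bialgebraOfTensor T hT Δ ε hΔ hε) _ _ ‹_› ι T hΔ hε hc
  exact ⟨hopfAlgebraOfTensor T hT Δ ε S hΔ hε hl hr, ‹_›, F, hR.symm.trans hF⟩

end HopfOfTensor

namespace IsPentagonObject

open Algebra.TensorProduct (includeLeft includeRight)

variable {k : Type*} [Field k] {A : Type*} [Ring A] [Algebra k A]

/-- Conjugation `a ↦ R⁻¹ (1 ⊗ a) R`. -/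
def conj (R : (A ⊗[k] A)ˣ) : A →ₐ[k] A ⊗[k] A :=
  AlgHom.ofLinearMap (LinearMap.mulRight k (R : A ⊗[k] A) ∘ₗ
      LinearMap.mulLeft k (↑R⁻¹ : A ⊗[k] A) ∘ₗ (includeRight : A →ₐ[k] A ⊗[k] A).toLinearMap)
    (by simp [← Algebra.TensorProduct.one_def])
    (fun x y => by
      have : (1 : A) ⊗ₜ[k] (x * y) =
          (1 ⊗ₜ x) * ((R : A ⊗[k] A) * (↑R⁻¹ : A ⊗[k] A)) * (1 ⊗ₜ y) := by simp
      simp only [LinearMap.comp_apply, AlgHom.toLinearMap_apply,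
        Algebra.TensorProduct.includeRight_apply, LinearMap.mulRight_apply,
        LinearMap.mulLeft_apply, this, mul_assoc])

theorem conj_apply (R : (A ⊗[k] A)ˣ) (a : A) : 
    conj R a = (↑R⁻¹ : A ⊗[k] A) * (1 ⊗ₜ a) * (R : A ⊗[k] A) := rfl

variable {R : (A ⊗[k] A)ˣ} (hR : IsPentagonObject k A (R : A ⊗[k] A))

include hR

theorem map_conj : Algebra.TensorProduct.map (conj R) (AlgHom.id k A) (R : A ⊗[k] A) =
    Algebra.TensorProduct.map (includeLeft : A →ₐ[k] A ⊗[k] A) (AlgHom.id k A) (R : A ⊗[k] A) *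
      Algebra.TensorProduct.map (includeRight : A →ₐ[k] A ⊗[k] A) (AlgHom.id k A)
        (R : A ⊗[k] A) := by
  let a := Algebra.TensorProduct.assoc k k k A A A
  apply a.injective
  have h13 (X : A ⊗[k] A) : a (Algebra.TensorProduct.map (includeLeft : A →ₐ[k] A ⊗[k] A)
      (AlgHom.id k A) X) = leg13 k A X := by
    have : a.toAlgHom.comp (Algebra.TensorProduct.map
        (includeLeft : A →ₐ[k] A ⊗[k] A) (AlgHom.id k A)) = leg13 k A := by
      ext x <;> simp [a]
    exact DFunLike.congr_fun this X
  have h23 (X : A ⊗[k] A) : a (Algebra.TensorProduct.map (includeRight : A →ₐ[k] A ⊗[k] A)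
      (AlgHom.id k A) X) = leg23 k A X := by
    have : a.toAlgHom.comp (Algebra.TensorProduct.map
        (includeRight : A →ₐ[k] A ⊗[k] A) (AlgHom.id k A)) = leg23 k A := by
      ext x <;> simp [a]
    exact DFunLike.congr_fun this X
  have key (X : A ⊗[k] A) : a (Algebra.TensorProduct.map (conj R) (AlgHom.id k A) X) =
      leg12 k A (↑R⁻¹ : A ⊗[k] A) * leg23 k A X * leg12 k A (R : A ⊗[k] A) := by
    induction X with
    | zero => simp
    | add x y hx hy => simp only [map_add, mul_add, add_mul, hx, hy]
    | tmul x y =>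
      have e : leg23 k A (x ⊗ₜ y) = a ((1 ⊗ₜ x) ⊗ₜ y) := rfl
      rw [e, leg12_eq_assoc, leg12_eq_assoc]
      change a _ = a _ * a _ * a _
      rw [← map_mul, ← map_mul]
      simp [conj_apply]
  rw [map_mul, h13, h23, key, mul_assoc, ← hR.pentagon, mul_assoc, ← mul_assoc, ← map_mul,
    Units.inv_mul, map_one, one_mul]

theorem sliceRight_mul_sliceRight (g g' : A →ₗ[k] k) :
    sliceRight g (R : A ⊗[k] A) * sliceRight g' (R : A ⊗[k] A) =
      sliceRight ((LinearMap.mul' k k ∘ₗ TensorProduct.map g g') ∘ₗ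
        LinearMap.mulRight k (↑R⁻¹ : A ⊗[k] A) ∘ₗ LinearMap.mulLeft k (R : A ⊗[k] A) ∘ₗ
          (includeLeft : A →ₐ[k] A ⊗[k] A).toLinearMap) (R : A ⊗[k] A) := by
  rw [← sliceRight_leg12_mul_leg13, ← sliceRight_leg23_mul_leg12_mul_leg23, ← hR.pentagon,
    mul_assoc, ← map_mul (leg23 k A), Units.mul_inv, map_one, mul_one]

theorem sliceLeft_mul_sliceLeft (f f' : A →ₗ[k] k) :
    sliceLeft f (R : A ⊗[k] A) * sliceLeft f' (R : A ⊗[k] A) =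
      sliceLeft ((LinearMap.mul' k k ∘ₗ TensorProduct.map f f') ∘ₗ (conj R).toLinearMap)
        (R : A ⊗[k] A) := by
  rw [← sliceLeft_leg_mul_leg, ← hR.map_conj, sliceLeft_map]

omit hR in
/-- The linear map sending a functional `g` to the slice `(id ⊗ g) X`. -/
def sliceRightₗ (X : A ⊗[k] A) : (A →ₗ[k] k) →ₗ[k] A where
  toFun g := sliceRight g X
  map_add' g g' := by simp [sliceRight, LinearMap.lTensor_add]
  map_smul' c g := by simp [sliceRight, LinearMap.lTensor_smul]

omit hR in
/-- The linear map sending a functional `f` to the slice `(f ⊗ id) X`. -/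
def sliceLeftₗ (X : A ⊗[k] A) : (A →ₗ[k] k) →ₗ[k] A where
  toFun f := sliceLeft f X
  map_add' f f' := by simp [sliceLeft, LinearMap.rTensor_add]
  map_smul' c f := by simp [sliceLeft, LinearMap.rTensor_smul]

theorem inv_mem_and_one_mem :
    (↑R⁻¹ : A ⊗[k] A) ∈ LinearMap.range (TensorProduct.mapIncl
      (LinearMap.range (sliceRightₗ (R : A ⊗[k] A)))
      (LinearMap.range (sliceLeftₗ (R : A ⊗[k] A)))) ∧
    (1 : A ⊗[k] A) ∈ LinearMap.range (TensorProduct.mapIncl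
      (LinearMap.range (sliceRightₗ (R : A ⊗[k] A)))
      (LinearMap.range (sliceLeftₗ (R : A ⊗[k] A)))) := by
  have := hR.finiteDimensional
  have hmem : (R : A ⊗[k] A) ∈ LinearMap.range (TensorProduct.mapIncl
      (LinearMap.range (sliceRightₗ (R : A ⊗[k] A)))
      (LinearMap.range (sliceLeftₗ (R : A ⊗[k] A)))) :=
    mem_range_mapIncl_of_slices (fun g => ⟨g, rfl⟩) (fun f => ⟨f, rfl⟩)
  have hinv {x : A ⊗[k] A} := inv_mul_mem_of_mul_mem (W := LinearMap.range (TensorProduct.mapIncl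
      (LinearMap.range (sliceRightₗ (R : A ⊗[k] A)))
      (LinearMap.range (sliceLeftₗ (R : A ⊗[k] A))))) R (x := x) (fun x hx =>
        mul_mem_range_mapIncl
        (by rintro _ ⟨g, rfl⟩ _ ⟨g', rfl⟩; exact ⟨_, (hR.sliceRight_mul_sliceRight g g').symm⟩)
        (by rintro _ ⟨f, rfl⟩ _ ⟨f', rfl⟩; exact ⟨_, (hR.sliceLeft_mul_sliceLeft f f').symm⟩)
        hmem hx)
  have h1 := hinv hmem
  rw [Units.inv_mul] at h1
  have h2 := hinv h1
  rw [mul_one] at h2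
  exact ⟨h2, h1⟩

variable [Nontrivial A]

omit hR in
theorem exists_functional_one : ∃ g : A →ₗ[k] k, g 1 = 1 := by
  obtain ⟨g, hg⟩ := (LinearMap.toSpanSingleton k A 1).exists_leftInverse_of_injective
    (LinearMap.ker_eq_bot.2 (by
      exact smul_left_injective k (one_ne_zero (α := A))))
  exact ⟨g, by simpa using LinearMap.congr_fun hg 1⟩

theorem exists_sliceRight_eq_one : ∃ g : A →ₗ[k] k, sliceRight g (R : A ⊗[k] A) = 1 := by
  obtain ⟨g, hg⟩ := exists_functional_one (k := k) (A := A)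
  have := sliceRight_mem_of_mem_range_mapIncl hR.inv_mem_and_one_mem.2 g
  rw [Algebra.TensorProduct.one_def, sliceRight_tmul, hg, one_smul] at this
  exact this

theorem exists_sliceLeft_eq_one : ∃ f : A →ₗ[k] k, sliceLeft f (R : A ⊗[k] A) = 1 := by
  obtain ⟨f, hf⟩ := exists_functional_one (k := k) (A := A)
  have := sliceLeft_mem_of_mem_range_mapIncl hR.inv_mem_and_one_mem.2 f
  rw [Algebra.TensorProduct.one_def, sliceLeft_tmul, hf, one_smul] at this
  exact this

/-- The algebra of left coefficients of a pentagon object. -/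
def coeffs : Subalgebra k A :=
  (LinearMap.range (sliceRightₗ (R : A ⊗[k] A))).toSubalgebra hR.exists_sliceRight_eq_one
    (by rintro _ _ ⟨g, rfl⟩ ⟨g', rfl⟩; exact ⟨_, (hR.sliceRight_mul_sliceRight g g').symm⟩)

/-- The first legs of the terms of `R` and `R⁻¹` generate a Hopf algebra `L`, and `R` is the image
of the canonical element of its Heisenberg double. Here `L` is given as a copy of the algebra of
left coefficients. -/
theorem exists_hopfAlgebra {L : Type*} [Ring L] [Algebra k L] (e : L ≃ₐ[k] hR.coeffs) :
    ∃ (H : HopfAlgebra k L) (_ : @FiniteDimensional k L _ _ H.toAlgebra.toModule)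
      (F : HeisenbergDouble k L →ₐ[k] A),
      (R : A ⊗[k] A) =
        Algebra.TensorProduct.map F F (HeisenbergDouble.canonicalElement k L) := by
  have := hR.finiteDimensional
  let ι : L →ₐ[k] A := hR.coeffs.val.comp e.toAlgHom
  have hι : Function.Injective ι := Subtype.val_injective.comp e.injective
  have hfd : FiniteDimensional k L := Module.Finite.of_injective ι.toLinearMap hι
  have hmem (g : A →ₗ[k] k) : ∃ l : L, ι l = sliceRight g (R : A ⊗[k] A) :=
    ⟨e.symm ⟨_, g, rfl⟩, congrArg Subtype.val (e.apply_symm_apply _)⟩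
  have hι1 : Function.Injective (Algebra.TensorProduct.map ι (AlgHom.id k A)) :=
    Module.Flat.rTensor_preserves_injective_linearMap (M := A) ι.toLinearMap hι
  have hιι : Function.Injective (Algebra.TensorProduct.map ι ι) :=
    TensorProduct.map_injective_of_flat_flat _ _ hι hι
  have hιι1 : Function.Injective
      (Algebra.TensorProduct.map (Algebra.TensorProduct.map ι ι) (AlgHom.id k A)) :=
    Module.Flat.rTensor_preserves_injective_linearMap (M := A)
      (Algebra.TensorProduct.map ι ι).toLinearMap hιι
  obtain ⟨T, hTR⟩ : ∃ T, Algebra.TensorProduct.map ι (AlgHom.id k A) T = (R : A ⊗[k] A) := by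
    choose l hl using hmem
    refine ⟨∑ i, l ((Module.Free.chooseBasis k A).coord i) ⊗ₜ Module.Free.chooseBasis k A i, ?_⟩
    simp only [map_sum, Algebra.TensorProduct.map_tmul, hl, AlgHom.id_apply]
    exact (eq_sum_sliceRight _).symm
  have hslice (g : A →ₗ[k] k) : ι (sliceRight g T) = sliceRight g (R : A ⊗[k] A) := by
    rw [← hTR, sliceRight_map]
  have hsurj (x : L) : ∃ g, sliceRight g T = x := by
    obtain ⟨g, hg⟩ := (e x).2
    exact ⟨g, hι ((hslice g).trans hg)⟩
  have hsl (f : A →ₗ[k] k) : sliceLeft (f ∘ₗ ι.toLinearMap) T = sliceLeft f (R : A ⊗[k] A) := by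
    rw [← hTR, sliceLeft_map]
  have hT (f : L →ₗ[k] k) (hf : sliceLeft f T = 0) : f = 0 := by
    ext x
    obtain ⟨g, rfl⟩ := hsurj x
    rw [apply_sliceRight, hf, map_zero, LinearMap.zero_apply]
  have hlegs : Algebra.TensorProduct.map (Algebra.TensorProduct.map ι ι) (AlgHom.id k A)
      (Algebra.TensorProduct.map (includeLeft : L →ₐ[k] L ⊗[k] L) (AlgHom.id k A) T *
        Algebra.TensorProduct.map (includeRight : L →ₐ[k] L ⊗[k] L) (AlgHom.id k A) T) =
      Algebra.TensorProduct.map (conj R) (AlgHom.id k A) (R : A ⊗[k] A) := by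
    rw [hR.map_conj, map_mul, ← map_id_comp_apply, ← map_id_comp_apply, ← hTR,
      ← map_id_comp_apply, ← map_id_comp_apply]
    congr 3 <;> (ext x; simp)
  have hrange (x : L) : ∃ y, Algebra.TensorProduct.map ι ι y = conj R (ι x) := by
    obtain ⟨g, rfl⟩ := hsurj x
    refine ⟨sliceRight g (Algebra.TensorProduct.map (includeLeft : L →ₐ[k] L ⊗[k] L)
      (AlgHom.id k A) T * Algebra.TensorProduct.map (includeRight : L →ₐ[k] L ⊗[k] L)
        (AlgHom.id k A) T), ?_⟩
    rw [← sliceRight_map, hlegs, sliceRight_map, hslice]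
  let Δ : L →ₐ[k] L ⊗[k] L :=
    (AlgEquiv.ofInjective (Algebra.TensorProduct.map ι ι) hιι).symm.toAlgHom.comp
      (((conj R).comp ι).codRestrict (Algebra.TensorProduct.map ι ι).range hrange)
  have hΔ' (x : L) : Algebra.TensorProduct.map ι ι (Δ x) = conj R (ι x) :=
    congrArg Subtype.val
      ((AlgEquiv.ofInjective (Algebra.TensorProduct.map ι ι) hιι).apply_symm_apply _)
  obtain ⟨f₀, hf₀⟩ := hR.exists_sliceLeft_eq_one
  have hε' (g : A →ₗ[k] k) : f₀ (sliceRight g (R : A ⊗[k] A)) = g 1 := by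
    rw [apply_sliceRight, hf₀]
  have hεmul (x y : L) : f₀ (ι (x * y)) = f₀ (ι x) * f₀ (ι y) := by
    obtain ⟨g, rfl⟩ := hsurj x
    obtain ⟨g', rfl⟩ := hsurj y
    rw [map_mul, hslice, hslice, hR.sliceRight_mul_sliceRight, hε', hε', hε']
    have h1 : LinearMap.mulRight k (↑R⁻¹ : A ⊗[k] A) (LinearMap.mulLeft k (R : A ⊗[k] A)
        ((includeLeft : A →ₐ[k] A ⊗[k] A) 1)) = 1 ⊗ₜ 1 := by
      simp [← Algebra.TensorProduct.one_def]
    simp only [LinearMap.comp_apply, AlgHom.toLinearMap_apply, h1, TensorProduct.map_tmul,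
      LinearMap.mul'_apply]
  have hεone : f₀ (ι 1) = 1 := by
    have h : f₀ (ι 1) * (f₀ (ι 1) - 1) = 0 := by
      rw [mul_sub, ← hεmul, mul_one, mul_one, sub_self]
    rcases mul_eq_zero.1 h with h | h
    · obtain ⟨g, hg⟩ := exists_functional_one (k := k) (A := A)
      have h' := hεmul 1 (sliceRight g T)
      rw [one_mul, h, zero_mul, hslice, hε', hg] at h'
      exact absurd h' one_ne_zero
    · exact sub_eq_zero.1 h
  let ε : L →ₐ[k] k := AlgHom.ofLinearMap (f₀ ∘ₗ ι.toLinearMap) hεone hεmul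
  have hantipode {X : A ⊗[k] A} (hX : X ∈ LinearMap.range (TensorProduct.mapIncl
      (LinearMap.range (sliceRightₗ (R : A ⊗[k] A)))
      (LinearMap.range (sliceLeftₗ (R : A ⊗[k] A))))) :
      ∃ S : L →ₗ[k] L, Algebra.TensorProduct.map ι (AlgHom.id k A) (S.rTensor A T) = X := by
    obtain ⟨x, rfl⟩ := hX
    induction x with
    | zero => exact ⟨0, by simp⟩
    | add x y hx hy =>
      obtain ⟨S, hS⟩ := hx
      obtain ⟨S', hS'⟩ := hy
      exact ⟨S + S', by rw [LinearMap.rTensor_add, LinearMap.add_apply, map_add, hS, hS', map_add]⟩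
    | tmul p h =>
      obtain ⟨_, g, rfl⟩ := p
      obtain ⟨_, f, rfl⟩ := h
      refine ⟨(f ∘ₗ ι.toLinearMap).smulRight (sliceRight g T), ?_⟩
      have hX (X : L ⊗[k] A) (F : L →ₗ[k] k) (l : L) :
          (F.smulRight l).rTensor A X = l ⊗ₜ sliceLeft F X := by
        induction X with
        | zero => simp
        | add x y hx hy => simp only [map_add, hx, hy, TensorProduct.tmul_add]
        | tmul a b => simp [TensorProduct.smul_tmul]
      rw [hX, Algebra.TensorProduct.map_tmul, hslice, hsl]
      rfl
  obtain ⟨S, hS⟩ := hantipode hR.inv_mem_and_one_mem.1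
  refine exists_hopfAlgebra_heisenbergDouble_hom ι T hT Δ ε S ?_ ?_ ?_ ?_ ?_ hTR
  · apply hιι1
    rw [hlegs, ← map_id_comp_apply]
    conv_rhs => rw [← hTR, ← map_id_comp_apply]
    congr 2
    ext x
    exact hΔ' x
  · apply (TensorProduct.lid k A).injective
    have hlid (X : k ⊗[k] A) : TensorProduct.lid k A X = sliceLeft LinearMap.id X := by
      simp [sliceLeft]
    have hεf : LinearMap.id ∘ₗ ε.toLinearMap = f₀ ∘ₗ ι.toLinearMap := rfl
    rw [hlid, sliceLeft_map, hεf, hsl, hf₀]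
    simp [Algebra.TensorProduct.one_def]
  · apply hι1
    rw [map_mul, hS, hTR, map_one, Units.inv_mul]
  · apply hι1
    rw [map_mul, hS, hTR, map_one, Units.mul_inv]
  · intro h
    apply hι1
    have : Algebra.TensorProduct.map ι (AlgHom.id k A)
        (Algebra.TensorProduct.map (AlgHom.id k L) ι (Δ h)) =
        Algebra.TensorProduct.map ι ι (Δ h) := by
      rw [← AlgHom.comp_apply, ← Algebra.TensorProduct.map_comp]
      rfl
    rw [map_mul, map_mul, hTR, this, hΔ', conj_apply, mul_assoc, Units.mul_inv_cancel_left]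
    simp

end IsPentagonObject

theorem IsPentagonObject.exists_heisenbergDouble (k : Type u) [Field k] (A : Type v) [Ring A]
    [Algebra k A] [Nontrivial A] {R : A ⊗[k] A} (hR : IsPentagonObject k A R) :
    ∃ (L : Type (max u w)) (_ : Ring L) (_ : HopfAlgebra k L) (_ : FiniteDimensional k L)
      (F : HeisenbergDouble k L →ₐ[k] A),
      R = Algebra.TensorProduct.map F F (HeisenbergDouble.canonicalElement k L) := by
  obtain ⟨R, rfl⟩ := hR.isUnit
  have := hR.finiteDimensional
  have : Small.{max u w} hR.coeffs :=
    ⟨ULift.{w} (Fin (Module.finrank k hR.coeffs) → k),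
      ⟨((Module.finBasis k hR.coeffs).equivFun.toEquiv).trans Equiv.ulift.symm⟩⟩
  obtain ⟨H, hfd, F, hF⟩ := hR.exists_hopfAlgebra (Shrink.algEquiv.{max u w} k hR.coeffs)
  exact ⟨_, _, H, hfd, F, hF⟩

theorem mainTheorem5 (k : Type u) [Field k] (A : Type v) [Ring A] [Algebra k A]
    (R : A ⊗[k] A) :
    IsPentagonObject k A R ↔
      FiniteDimensional k A ∧
        ∃ (L : Type (max u w)) (_ : Ring L) (_ : HopfAlgebra k L) (_ : FiniteDimensional k L)
          (F : HeisenbergDouble k L →ₐ[k] A),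
          R = Algebra.TensorProduct.map F F (HeisenbergDouble.canonicalElement k L) := by
  constructor
  · intro hR
    refine ⟨hR.finiteDimensional, ?_⟩
    cases subsingleton_or_nontrivial A
    · have h1 : IsPentagonObject k k (1 : k ⊗[k] k) :=
        ⟨inferInstance, isUnit_one, by simp only [map_one, mul_one]⟩
      obtain ⟨L, i, H, hfd, F, -⟩ := IsPentagonObject.exists_heisenbergDouble.{u, u, w} k k h1
      have : Subsingleton (A ⊗[k] A) := subsingleton_of_zero_eq_one (by
        rw [Algebra.TensorProduct.one_def, Subsingleton.elim (1 : A) 0, TensorProduct.zero_tmul])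
      exact ⟨L, i, H, hfd, (Algebra.ofId k A).comp F, Subsingleton.elim _ _⟩
    · exact IsPentagonObject.exists_heisenbergDouble k A hR
  · rintro ⟨hA, L, _, _, _, F, rfl⟩
    exact HeisenbergDouble.isPentagonObject_canonicalElement.map F

end
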